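/- Let $r>1$ be an irrational real number, let $P_r=\{\lfloor nr\rfloor : n\in\mathbb Z\setminus\{0\}\}$, and consider the first-order structure $\mathfrak Z=(\mathbb Z,+,-,0,1,P_r)$, where $P_r$ interprets a unary predicate symbol; "definable" means first-order definable with parameters from $\mathbb Z$. Say that $X\subseteq\mathbb Z$ has the backward uniform gaps property if there is an integer $M\ge 1$ such that $X\cap\{x-1,x-2,\dots,x-M\}\neq\emptyset$ for every $x\in X$. Then the ordering $\{(x,y)\in\mathbb Z^2 : x<y\}$ of $\mathbb Z$ is not definable in $\mathfrak Z$. Moreover, every infinite subset of $\mathbb Z$ that is definable in $\mathfrak Z$ has the backward uniform gaps property, whereas the set $\mathbb N_+=\{x\in\mathbb Z : x>0\}$ of positive integers does not. -/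

import Mathlib

/-- The function symbols `+`, `-` (unary), `0`, `1`. -/
inductive BeattyFunc : ℕ → Type
  | add : BeattyFunc 2
  | neg : BeattyFunc 1
  | zero : BeattyFunc 0
  | one : BeattyFunc 0

/-- The only relation symbol (besides equality): a unary predicate `P`. -/
inductive BeattyRel : ℕ → Type
  | P : BeattyRel 1

/-- The first-order language `L_P = {+, -, 0, 1, P}`. -/
def beattyLanguage : FirstOrder.Language.{0, 0} where
  Functions := BeattyFunc
  Relations := BeattyRel

/-- The set `P_r = {⌊n r⌋ : n ∈ ℤ, n ≠ 0}`. -/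
def beattySet (r : ℝ) : Set ℤ :=
  {k | ∃ n : ℤ, n ≠ 0 ∧ k = ⌊(n : ℝ) * r⌋}

/-- The structure `(ℤ, +, -, 0, 1, P_r)`. -/
@[reducible] def beattyStructure (r : ℝ) : FirstOrder.Language.Structure beattyLanguage ℤ where
  funMap {n} (f : BeattyFunc n) :=
    match n, f with
    | _, .add => fun v => v 0 + v 1
    | _, .neg => fun v => -v 0
    | _, .zero => fun _ => 0
    | _, .one => fun _ => 1
  RelMap {n} (R : BeattyRel n) :=
    match n, R with
    | _, .P => fun v => v 0 ∈ beattySet r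

/-- `X ⊆ ℤ` is definable (parameters from `ℤ` allowed) in `(ℤ, +, -, 0, 1, P_r)`. -/
def BeattyDefinable₁ (r : ℝ) (X : Set ℤ) : Prop :=
  letI := beattyStructure r
  (Set.univ : Set ℤ).Definable₁ beattyLanguage X

/-- `R ⊆ ℤ × ℤ` is definable (parameters from `ℤ` allowed) in `(ℤ, +, -, 0, 1, P_r)`. -/
def BeattyDefinable₂ (r : ℝ) (R : Set (ℤ × ℤ)) : Prop :=
  letI := beattyStructure r
  (Set.univ : Set ℤ).Definable₂ beattyLanguage R

/-- The backward uniform gaps property: there is `M ≥ 1` such that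
`X ∩ {x - 1, …, x - M}` is nonempty for every `x ∈ X`. -/
def BackwardUniformGaps (X : Set ℤ) : Prop :=
  ∃ M : ℕ, 0 < M ∧ ∀ x ∈ X, (X ∩ Set.Icc (x - (M : ℤ)) (x - 1)).Nonempty

open FirstOrder Language BoundedFormula

/-! Put a = 1/r and H = ℤ + ℤa, a dense subgroup of ℝ. An integer k lies in P_r iff fract(ak) > 1 -
a (`mem_beattySet_iff`), and k ↦ fract(ak) is a bijection from ℤ onto H ∩ [0,1). Atomic formulas
thus become sign conditions on integral linear forms in 1, a and the numbers fract(a wᵢ). A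
back-and-forth argument in H replaces quantifier elimination: the truth of a formula depends only on
the signs of the forms with coefficients at most K and on the entries modulo K!H
(`exists_sim_realize`). Density of H supplies the witnesses (`Sim.exists_extend`). For an infinite
definable X, some x ∈ X has fract(ax) off the finitely many zeros of these forms. Then X contains
every x + K!z with az close enough to an integer, and such z recur with bounded gaps
(`exists_syndetic`). The positive integers have a least element, so they are not definable, and
hence neither is the order. -/

/-- The integral linear form with coefficients `l`, evaluated at the real tuple `u`. -/
noncomputable def intForm {ι : Type*} [Fintype ι] (l : ι → ℤ) (u : ι → ℝ) : ℝ :=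
  ∑ i, (l i : ℝ) * u i

section intForm

variable {ι : Type*} [Fintype ι]

theorem intForm_neg (l : ι → ℤ) (u : ι → ℝ) : intForm (-l) u = -intForm l u := by
  simp [intForm]

theorem intForm_add (l m : ι → ℤ) (u : ι → ℝ) :
    intForm (l + m) u = intForm l u + intForm m u := by
  simp [intForm, add_mul, Finset.sum_add_distrib]

theorem intForm_smul (k : ℤ) (l : ι → ℤ) (u : ι → ℝ) :
    intForm (k • l) u = k * intForm l u := by
  simp [intForm, Finset.mul_sum, mul_assoc]

theorem finite_setOf_abs_le (K : ℕ) : {l : ι → ℤ | ∀ i, |l i| ≤ K}.Finite := by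
  refine (Set.Finite.pi' fun _ : ι => Set.finite_Icc (-(K : ℤ)) K).subset fun l hl i => ?_
  exact abs_le.1 (hl i)

end intForm

/-! ### Similarity of real tuples and back-and-forth -/

/-- Two real tuples are `K`-similar if integral linear forms with coefficients of size at most `K`
have the same sign at both, and their entries are congruent modulo `K! H`. -/
def Sim {ι : Type*} [Fintype ι] (H : AddSubgroup ℝ) (K : ℕ) (u v : ι → ℝ) : Prop :=
  (∀ l : ι → ℤ, (∀ i, |l i| ≤ K) → (0 < intForm l u ↔ 0 < intForm l v)) ∧
    ∀ i, ∃ h ∈ H, u i - v i = K.factorial * h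

section Sim

variable {ι : Type*} [Fintype ι] {H : AddSubgroup ℝ} {K : ℕ} {u v : ι → ℝ}

theorem Sim.symm (h : Sim H K u v) : Sim H K v u := by
  refine ⟨fun l hl => (h.1 l hl).symm, fun i => ?_⟩
  obtain ⟨x, hx, e⟩ := h.2 i
  exact ⟨-x, H.neg_mem hx, by linarith⟩

theorem AddSubgroup.natCast_mul_mem_real (H : AddSubgroup ℝ) {x : ℝ} (hx : x ∈ H) (n : ℕ) :
    (n : ℝ) * x ∈ H := by
  simpa using H.nsmul_mem hx n

theorem AddSubgroup.intCast_mul_mem_real (H : AddSubgroup ℝ) {x : ℝ} (hx : x ∈ H) (n : ℤ) :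
    (n : ℝ) * x ∈ H := by
  simpa using H.zsmul_mem hx n

theorem Sim.mono {K' : ℕ} (h : Sim H K' u v) (hK : K ≤ K') : Sim H K u v := by
  refine ⟨fun l hl => h.1 l fun i => (hl i).trans (by exact_mod_cast hK), fun i => ?_⟩
  obtain ⟨x, hx, e⟩ := h.2 i
  obtain ⟨m, hm⟩ := Nat.factorial_dvd_factorial hK
  exact ⟨m * x, H.natCast_mul_mem_real hx m, by rw [e, hm]; push_cast; ring⟩

theorem Sim.intForm_sub (h : Sim H K u v) (l : ι → ℤ) :
    ∃ x ∈ H, intForm l u - intForm l v = K.factorial * x := by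
  choose x hx e using h.2
  refine ⟨∑ i, (l i : ℝ) * x i, H.sum_mem fun i _ => H.intCast_mul_mem_real (hx i) _, ?_⟩
  simp only [intForm, ← Finset.sum_sub_distrib, ← mul_sub, e, Finset.mul_sum]
  exact Finset.sum_congr rfl fun i _ => by ring

theorem exists_mem_coset_of_isOpen (hH : Dense (H : Set ℝ)) {N : ℕ} (hN : N ≠ 0) (c : ℝ)
    {U : Set ℝ} (hU : IsOpen U) (hne : U.Nonempty) : ∃ h ∈ H, c - N * h ∈ U := by
  have hN' : (N : ℝ) ≠ 0 := by exact_mod_cast hN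
  obtain ⟨y, hy⟩ := hne
  obtain ⟨h, h1, h2⟩ := hH.exists_mem_open
    (hU.preimage (by fun_prop : Continuous fun h : ℝ => c - N * h))
    ⟨(c - y) / N, by
      change c - N * ((c - y) / N) ∈ U
      rwa [mul_div_cancel₀ _ hN', sub_sub_cancel]⟩
  exact ⟨h, h1, h2⟩

theorem abs_mul_add_mul_le {K : ℕ} {a b c d : ℤ} (ha : |a| ≤ K) (hb : |b| ≤ K) (hc : |c| ≤ K)
    (hd : |d| ≤ K) : |a * b + c * d| ≤ (2 * K ^ 2 + K * K.factorial : ℕ) := by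
  have h1 : |a * b| ≤ K * K := by
    rw [abs_mul]; exact mul_le_mul ha hb (abs_nonneg _) (by positivity)
  have h2 : |c * d| ≤ K * K := by
    rw [abs_mul]; exact mul_le_mul hc hd (abs_nonneg _) (by positivity)
  have h3 := abs_add_le (a * b) (c * d)
  have h4 : (0 : ℤ) ≤ K * K.factorial := by positivity
  push_cast
  nlinarith

/-- The back-and-forth step. -/
theorem Sim.exists_extend (hH : Dense (H : Set ℝ))
    (h : Sim H (2 * K ^ 2 + K * K.factorial) u v) {c : ℝ} (hc : c ∈ H) :
    ∃ d ∈ H, (∀ (l : ι → ℤ) (k : ℤ), (∀ i, |l i| ≤ K) → |k| ≤ K →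
      (0 < k * c + intForm l u ↔ 0 < k * d + intForm l v)) ∧
      ∃ x ∈ H, c - d = K.factorial * x := by
  -- The term 2K² bounds the coefficients of a combination of two forms, used to compare them; the
  -- term K·K! makes k·K! divide K'! for 0 < k ≤ K.
  set K' := 2 * K ^ 2 + K * K.factorial with hK'
  have key : ∀ (l m : ι → ℤ) (a b : ℤ), (∀ i, |l i| ≤ K) → (∀ i, |m i| ≤ K) → |a| ≤ K →
      |b| ≤ K → (0 < a * intForm l u + b * intForm m u ↔
        0 < a * intForm l v + b * intForm m v) := by
    intro l m a b hl hm ha hb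
    have := h.1 (a • l + b • m) fun i => abs_mul_add_mul_le ha (hl i) hb (hm i)
    simpa only [intForm_add, intForm_smul] using this
  by_cases hex : ∃ (l : ι → ℤ) (k : ℤ), (∀ i, |l i| ≤ K) ∧ |k| ≤ K ∧ 0 < k ∧
      k * c = intForm l u
  -- Here c is a rational multiple of a form at u, so d is forced by k d = l(v). Divisibility of K'!
  -- by k·K! puts c - d in K!H.
  · obtain ⟨l, k, hl, hk, hk0, e⟩ := hex
    obtain ⟨x, hx, ex⟩ := h.intForm_sub l
    have hkR : (0 : ℝ) < k := by exact_mod_cast hk0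
    have hdvd : k * K.factorial ∣ (K'.factorial : ℤ) := by
      lift k to ℕ using hk0.le
      have hk1 : k ≤ K := by simpa using hk
      have hk2 : 0 < k := by exact_mod_cast hk0
      have h1 : k * K.factorial ≤ K' :=
        (Nat.mul_le_mul_right _ hk1).trans (Nat.le_add_left _ _)
      exact_mod_cast Nat.dvd_factorial (by positivity) h1
    obtain ⟨m, hm⟩ := hdvd
    have hm' : (K'.factorial : ℝ) = k * K.factorial * m := by exact_mod_cast hm
    have hmx : (m : ℝ) * x ∈ H := H.intCast_mul_mem_real hx m
    have ed : k * (c - K.factorial * (m * x)) = intForm l v := by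
      rw [hm'] at ex; linear_combination e + ex
    refine ⟨c - K.factorial * (m * x), H.sub_mem hc (H.natCast_mul_mem_real hmx _),
      fun l' k' hl' hk' => ?_, m * x, hmx, by ring⟩
    have := key l l' k' k hl hl' hk' hk
    rw [← e, ← ed] at this
    have e2 : ∀ y z : ℝ, k' * (k * y) + k * z = k * (k' * y + z) := fun y z => by ring
    rw [e2, e2] at this
    simpa only [mul_pos_iff_of_pos_left hkR] using this
  -- Now c lies strictly between the bounds l(u)/k. By `key` the lower bounds at v stay below the
  -- upper ones, leaving a nonempty open set that the dense coset c + K!H meets.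
  · push Not at hex
    set S : Set ((ι → ℤ) × ℤ) := {p | (∀ i, |p.1 i| ≤ K) ∧ p.2 ∈ Set.Ioc (0 : ℤ) K} with hS
    have hSfin : S.Finite :=
      ((finite_setOf_abs_le K).prod (Set.finite_Ioc (0 : ℤ) K)).subset fun p hp => hp
    have hSk : ∀ p ∈ S, |p.2| ≤ K ∧ (0 : ℝ) < p.2 := fun p hp =>
      ⟨by rw [abs_of_pos hp.2.1]; exact hp.2.2, by exact_mod_cast hp.2.1⟩
    let lo := {p ∈ S | intForm p.1 u < p.2 * c}
    let hi := {p ∈ S | p.2 * c < intForm p.1 u}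
    have hlo : lo.Finite := hSfin.subset fun p hp => hp.1
    have hhi : hi.Finite := hSfin.subset fun p hp => hp.1
    let U : Set ℝ := (⋂ p ∈ lo, Set.Ioi (intForm p.1 v / p.2)) ∩
      ⋂ p ∈ hi, Set.Iio (intForm p.1 v / p.2)
    have hUo : IsOpen U := (hlo.isOpen_biInter fun _ _ => isOpen_Ioi).inter
      (hhi.isOpen_biInter fun _ _ => isOpen_Iio)
    have hUne : U.Nonempty := by
      classical
      obtain ⟨m, hm1, hm2⟩ := Order.exists_between_finsets
        (lo := hlo.toFinset.image fun p => intForm p.1 v / p.2)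
        (hi := hhi.toFinset.image fun p => intForm p.1 v / p.2) (by
          simp only [Finset.mem_image, Set.Finite.mem_toFinset]
          rintro _ ⟨p, hp, rfl⟩ _ ⟨q, hq, rfl⟩
          have hp' := hSk p hp.1
          have hq' := hSk q hq.1
          have := key p.1 q.1 (-q.2) p.2 hp.1.1 hq.1.1 (by rw [abs_neg]; exact hq'.1) hp'.1
          rw [div_lt_div_iff₀ hp'.2 hq'.2]
          push_cast at this
          have h1 := mul_lt_mul_of_pos_left hp.2 hq'.2
          have h2 := mul_lt_mul_of_pos_left hq.2 hp'.2
          have := this.1 (by linarith)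
          linarith)
      refine ⟨m, Set.mem_iInter₂.2 fun p hp => hm1 _ ?_, Set.mem_iInter₂.2 fun p hp => hm2 _ ?_⟩
      · exact Finset.mem_image_of_mem _ (hlo.mem_toFinset.2 hp)
      · exact Finset.mem_image_of_mem (fun p : (ι → ℤ) × ℤ => intForm p.1 v / p.2)
          (hhi.mem_toFinset.2 hp)
    obtain ⟨x, hx, hxU⟩ := exists_mem_coset_of_isOpen hH K.factorial_ne_zero c hUo hUne
    set d := c - K.factorial * x with hd
    have cmp : ∀ p ∈ S, (intForm p.1 u < p.2 * c → intForm p.1 v < p.2 * d) ∧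
        (p.2 * c < intForm p.1 u → p.2 * d < intForm p.1 v) := by
      refine fun p hp => ⟨fun h1 => ?_, fun h1 => ?_⟩
      · have : intForm p.1 v / p.2 < d := Set.mem_iInter₂.1 hxU.1 p ⟨hp, h1⟩
        rwa [div_lt_iff₀' (hSk p hp).2] at this
      · have : d < intForm p.1 v / p.2 := Set.mem_iInter₂.1 hxU.2 p ⟨hp, h1⟩
        rwa [lt_div_iff₀' (hSk p hp).2] at this
    refine ⟨d, H.sub_mem hc (H.natCast_mul_mem_real hx _), fun l k hl hk => ?_, x, hx, by ring⟩
    rcases lt_trichotomy k 0 with hk0 | rfl | hk0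
    · have hp : (l, -k) ∈ S := ⟨hl, by simpa using hk0, (neg_le_abs k).trans hk⟩
      have h1 := cmp _ hp
      have h2 := hex l (-k) hl (by rwa [abs_neg]) (by omega)
      push_cast at h1 h2
      constructor
      · intro h3; linarith [h1.2 (by linarith)]
      · intro h3
        rcases lt_or_gt_of_ne h2 with h4 | h4
        · linarith
        · linarith [h1.1 h4]
    · simpa using h.1 l fun i => (hl i).trans (by
        have : K ≤ K' := by
          rw [hK']; nlinarith [Nat.le_mul_of_pos_right K K.factorial_pos]
        exact_mod_cast this)
    · have hp : (-l, k) ∈ S := ⟨fun i => by simpa using hl i, hk0, (le_abs_self k).trans hk⟩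
      have h1 := cmp _ hp
      have h2 := hex (-l) k (fun i => by simpa using hl i) hk hk0
      simp only [intForm_neg] at h1 h2
      constructor
      · intro h3; linarith [h1.1 (by linarith)]
      · intro h3
        rcases lt_or_gt_of_ne h2 with h4 | h4
        · linarith [h1.2 h4]
        · linarith

end Sim


/-! ### The Beatty set through fractional parts -/

theorem mem_beattySet_iff {r : ℝ} (hr : 1 < r) (hirr : Irrational r) (k : ℤ) :
    k ∈ beattySet r ↔ 1 - r⁻¹ < Int.fract (r⁻¹ * k) := by
  have hr0 : 0 < r := by linarith
  have ha0 : 0 < r⁻¹ := inv_pos.2 hr0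
  have ha1 : r⁻¹ < 1 := inv_lt_one_of_one_lt₀ hr
  -- With a = 1/r < 1, k = ⌊nr⌋ means ak ≤ n < ak + a. Irrationality and n ≠ 0 exclude n = ak, so n
  -- must be ⌊ak⌋ + 1.
  have hfloor : ∀ n : ℤ, k = ⌊(n : ℝ) * r⌋ ↔ r⁻¹ * k ≤ n ∧ n < r⁻¹ * k + r⁻¹ := by
    intro n
    rw [eq_comm, Int.floor_eq_iff, ← div_le_iff₀ hr0, ← lt_div_iff₀ hr0, div_eq_inv_mul,
      div_eq_inv_mul, mul_add, mul_one]
  constructor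
  · rintro ⟨n, hn, h⟩
    obtain ⟨h1, h2⟩ := (hfloor n).1 h
    have hne : r⁻¹ * k ≠ n := by
      intro e
      rcases eq_or_ne k 0 with rfl | hk
      · apply hn
        have : (n : ℝ) = 0 := by rw [← e]; simp
        exact_mod_cast this
      · exact (hirr.inv.mul_intCast hk).ne_int n e
    have hf : ⌊r⁻¹ * k⌋ = n - 1 := by
      rw [Int.floor_eq_iff]; push_cast
      exact ⟨by linarith, by linarith [lt_of_le_of_ne h1 hne]⟩
    rw [Int.fract, hf]; push_cast; linarith
  · intro h
    have h1 := Int.lt_floor_add_one (r⁻¹ * k)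
    have h2 : (⌊r⁻¹ * k⌋ : ℝ) + 1 < r⁻¹ * k + r⁻¹ := by rw [Int.fract] at h; linarith
    refine ⟨⌊r⁻¹ * k⌋ + 1, fun h0 => ?_, (hfloor _).2 ⟨by push_cast; linarith, by push_cast; linarith⟩⟩
    have h0' : (⌊r⁻¹ * k⌋ : ℝ) + 1 = 0 := by exact_mod_cast h0
    rw [h0'] at h1 h2
    have h3 : (k : ℝ) < 0 := by
      by_contra hk
      have := mul_nonneg ha0.le (not_lt.1 hk)
      linarith
    have h4 : (-1 : ℝ) < k := by
      have : 0 < r⁻¹ * (k + 1) := by linarith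
      linarith [(mul_pos_iff_of_pos_left ha0).1 this]
    have h3' : k < 0 := by exact_mod_cast h3
    have h4' : -1 < k := by exact_mod_cast h4
    omega

/-! ### Atomic conditions as signs of linear forms -/

/-- The tuple of fractional parts of `a * w i`, together with the constants `1` and `a`. -/
noncomputable def fractTuple {ι : Type*} (a : ℝ) (w : ι → ℤ) : Bool ⊕ ι → ℝ :=
  Sum.elim (fun b => cond b 1 a) fun i => Int.fract (a * w i)

section fractTuple

variable {ι : Type*} [Fintype ι] {a : ℝ}

theorem intForm_fractTuple (p q : ℤ) (l : ι → ℤ) (w : ι → ℤ) :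
    intForm (Sum.elim (fun b => cond b p q) l) (fractTuple a w) =
      p + q * a + intForm l fun i => Int.fract (a * w i) := by
  simp [intForm, fractTuple, Fintype.sum_sum_type]

theorem Sim.pos_iff {H : AddSubgroup ℝ} {K : ℕ} {w w' : ι → ℤ}
    (h : Sim H K (fractTuple a w) (fractTuple a w')) {p q : ℤ} {l : ι → ℤ} (hp : |p| ≤ K)
    (hq : |q| ≤ K) (hl : ∀ i, |l i| ≤ K) :
    0 < p + q * a + (intForm l fun i => Int.fract (a * w i)) ↔
      0 < p + q * a + intForm l fun i => Int.fract (a * w' i) := by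
  have := h.1 (Sum.elim (fun b => cond b p q) l) (by
    rintro (b | i)
    · cases b
      · exact hq
      · exact hp
    · exact hl i)
  simpa only [intForm_fractTuple] using this

theorem mul_affine_eq (w l : ι → ℤ) (q : ℤ) :
    a * ((∑ i, l i * w i + q : ℤ) : ℝ) =
      q * a + (intForm l fun i => Int.fract (a * w i)) + (∑ i, l i * ⌊a * w i⌋ : ℤ) := by
  have : ∀ i, (l i : ℝ) * Int.fract (a * w i) = a * (l i * w i) - l i * ⌊a * w i⌋ := fun i => by
    rw [Int.fract]; ring
  simp only [intForm, this, Finset.sum_sub_distrib, ← Finset.mul_sum]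
  push_cast
  ring

theorem abs_affine_le (ha0 : 0 < a) (ha1 : a < 1) (w l : ι → ℤ) (q : ℤ) :
    |q * a + intForm l fun i => Int.fract (a * w i)| ≤
      (q.natAbs + ∑ i, (l i).natAbs : ℕ) := by
  push_cast
  simp only [Nat.cast_natAbs, Int.cast_abs]
  refine (abs_add_le _ _).trans (add_le_add ?_ ((Finset.abs_sum_le_sum_abs _ _).trans
    (Finset.sum_le_sum fun i _ => ?_)))
  · rw [abs_mul, abs_of_pos ha0]
    exact mul_le_of_le_one_right (abs_nonneg _) ha1.le
  · rw [abs_mul, Int.abs_fract]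
    exact mul_le_of_le_one_right (abs_nonneg _) (Int.fract_lt_one _).le

theorem affine_eq_zero_iff (hirr : Irrational a) (w l : ι → ℤ) (q : ℤ) :
    ∑ i, l i * w i + q = 0 ↔
      ∃ m : ℤ, (q * a + intForm l fun i => Int.fract (a * w i)) = m := by
  have e := mul_affine_eq (a := a) w l q
  constructor
  · intro h
    rw [h] at e
    exact ⟨-∑ i, l i * ⌊a * w i⌋, by push_cast at e ⊢; linarith⟩
  · rintro ⟨m, hm⟩
    by_contra h
    refine (hirr.mul_intCast h).ne_int (m + ∑ i, l i * ⌊a * w i⌋) ?_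
    rw [e, hm]; push_cast; rfl

theorem lt_fract_affine_iff (ha1 : a < 1) (w l : ι → ℤ) (q : ℤ) :
    1 - a < Int.fract (a * ((∑ i, l i * w i + q : ℤ) : ℝ)) ↔
      ∃ m : ℤ, m + 1 - a < (q * a + intForm l fun i => Int.fract (a * w i)) ∧
        (q * a + intForm l fun i => Int.fract (a * w i)) < m + 1 := by
  rw [mul_affine_eq, Int.fract_add_intCast]
  set E := q * a + intForm l fun i => Int.fract (a * w i)
  constructor
  · intro h
    refine ⟨⌊E⌋, ?_, Int.lt_floor_add_one E⟩
    rw [Int.fract] at h; linarith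
  · rintro ⟨m, h1, h2⟩
    have : ⌊E⌋ = m := Int.floor_eq_iff.2 ⟨by linarith, h2⟩
    rw [Int.fract, this]; linarith

/-- Up to an integer, a times the affine value is a form of absolute value at most B. Only finitely
many integers m can therefore witness either condition, and each is tested by signs of forms with
bounded coefficients; equality with m means that neither difference is positive. -/
theorem exists_sim_affine (ha0 : 0 < a) (ha1 : a < 1) (hirr : Irrational a)
    (H : AddSubgroup ℝ) (l : ι → ℤ) (q : ℤ) : ∃ K : ℕ, ∀ w w' : ι → ℤ,
      Sim H K (fractTuple a w) (fractTuple a w') →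
      (∑ i, l i * w i + q = 0 → ∑ i, l i * w' i + q = 0) ∧
      (1 - a < Int.fract (a * ((∑ i, l i * w i + q : ℤ) : ℝ)) →
        1 - a < Int.fract (a * ((∑ i, l i * w' i + q : ℤ) : ℝ))) := by
  set B : ℕ := q.natAbs + ∑ i, (l i).natAbs with hB
  refine ⟨B + 2, fun w w' h => ?_⟩
  have hq : |q| ≤ B := by
    rw [Int.abs_eq_natAbs]; exact_mod_cast Nat.le_add_right _ _
  have hl : ∀ i, |l i| ≤ (B + 2 : ℕ) := fun i => by
    rw [Int.abs_eq_natAbs]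
    have : (l i).natAbs ≤ ∑ i, (l i).natAbs :=
      Finset.single_le_sum (f := fun i => (l i).natAbs) (fun _ _ => Nat.zero_le _)
        (Finset.mem_univ i)
    exact_mod_cast this.trans (by omega)
  have hl' : ∀ i, |(-l) i| ≤ (B + 2 : ℕ) := fun i => by simpa using hl i
  have hE := abs_affine_le ha0 ha1 w l q
  rw [← hB] at hE
  have hE' := abs_le.1 hE
  rw [affine_eq_zero_iff hirr, affine_eq_zero_iff hirr, lt_fract_affine_iff ha1,
    lt_fract_affine_iff ha1]
  have pos : ∀ p q' : ℤ, |p| ≤ (B + 2 : ℕ) → |q'| ≤ (B + 2 : ℕ) → _ := fun p q' hp hq' =>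
    h.pos_iff hp hq' hl
  have neg : ∀ p q' : ℤ, |p| ≤ (B + 2 : ℕ) → |q'| ≤ (B + 2 : ℕ) → _ := fun p q' hp hq' =>
    h.pos_iff hp hq' hl'
  simp only [intForm_neg] at neg
  rw [abs_le] at hq
  refine ⟨?_, ?_⟩
  · rintro ⟨m, hm⟩
    have hm1 : m ≤ B := by exact_mod_cast (hm ▸ hE'.2 : (m : ℝ) ≤ B)
    have hm2 : -B ≤ m := by exact_mod_cast (hm ▸ hE'.1 : -(B : ℝ) ≤ m)
    refine ⟨m, ?_⟩
    have h1 := pos (-m) q (abs_le.2 ⟨by push_cast; omega, by push_cast; omega⟩)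
      (abs_le.2 ⟨by push_cast; omega, by push_cast; omega⟩)
    have h2 := neg m (-q) (abs_le.2 ⟨by push_cast; omega, by push_cast; omega⟩)
      (abs_le.2 ⟨by push_cast; omega, by push_cast; omega⟩)
    push_cast at h1 h2
    apply le_antisymm
    · by_contra! h3
      linarith [h1.2 (by linarith)]
    · by_contra! h3
      linarith [h2.2 (by linarith)]
  · rintro ⟨m, hm, hm'⟩
    have hm1 : m < B := by exact_mod_cast (by linarith : (m : ℝ) < B)
    have hm2 : -B < m + 1 := by exact_mod_cast (by linarith : -(B : ℝ) < m + 1)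
    have h1 := pos (-m - 1) (q + 1) (abs_le.2 ⟨by push_cast; omega, by push_cast; omega⟩)
      (abs_le.2 ⟨by push_cast; omega, by push_cast; omega⟩)
    have h2 := neg (m + 1) (-q) (abs_le.2 ⟨by push_cast; omega, by push_cast; omega⟩)
      (abs_le.2 ⟨by push_cast; omega, by push_cast; omega⟩)
    push_cast at h1 h2
    exact ⟨m, by linarith [h1.1 (by linarith)], by linarith [h2.1 (by linarith)]⟩

theorem mem_closure_one_iff {x : ℝ} :
    x ∈ AddSubgroup.closure {1, a} ↔ ∃ m n : ℤ, (m : ℝ) + n * a = x := by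
  simp [AddSubgroup.mem_closure_pair]

theorem fract_mem_closure (k : ℤ) : Int.fract (a * k) ∈ AddSubgroup.closure {1, a} :=
  mem_closure_one_iff.2 ⟨-⌊a * k⌋, k, by rw [Int.fract]; push_cast; ring⟩

theorem dense_closure_one (hirr : Irrational a) :
    Dense (AddSubgroup.closure {1, a} : Set ℝ) := by
  rw [dense_addSubgroupClosure_pair_iff, one_div]
  exact hirr.inv

theorem intForm_fractTuple_snoc {V : Type*} [Fintype V] {n : ℕ} (v : V → ℤ) (xs : Fin n → ℤ)
    (x : ℤ) (l : Bool ⊕ (V ⊕ Fin (n + 1)) → ℤ) :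
    intForm l (fractTuple a (Sum.elim v (Fin.snoc xs x : Fin (n + 1) → ℤ))) =
      l (.inr (.inr (Fin.last n))) * Int.fract (a * x) +
        intForm (l ∘ Sum.map id (Sum.map id Fin.castSucc)) (fractTuple a (Sum.elim v xs)) := by
  simp only [intForm, fractTuple, Fintype.sum_sum_type, Fin.sum_univ_castSucc, Sum.elim_inl,
    Sum.elim_inr, Fin.snoc_castSucc, Fin.snoc_last, Function.comp_apply, Sum.map_inl,
    Sum.map_inr, id_eq]
  ring

theorem Sim.exists_snoc (hirr : Irrational a) {V : Type*} [Fintype V] {n K : ℕ} (hK : 1 ≤ K)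
    {v v' : V → ℤ} {xs xs' : Fin n → ℤ}
    (h : Sim (AddSubgroup.closure {1, a}) (2 * K ^ 2 + K * K.factorial)
      (fractTuple a (Sum.elim v xs)) (fractTuple a (Sum.elim v' xs'))) (x : ℤ) :
    ∃ x' : ℤ, Sim (AddSubgroup.closure {1, a}) K
      (fractTuple a (Sum.elim v (Fin.snoc xs x : Fin (n + 1) → ℤ)))
      (fractTuple a (Sum.elim v' (Fin.snoc xs' x' : Fin (n + 1) → ℤ))) := by
  obtain ⟨d, hd, h1, h2⟩ := h.exists_extend (dense_closure_one hirr) (fract_mem_closure x)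
  have hKz : (1 : ℤ) ≤ K := by exact_mod_cast hK
  -- Since K ≥ 1, the signs of -c and 1 - c are among those preserved, which keeps d in [0,1). An
  -- element m + ka of H there is fract(ak), so k is the new integer.
  have hd0 : 0 ≤ d := by
    have := h1 0 (-1) (by simp) (by simpa using hKz)
    simp only [intForm, Pi.zero_apply, Int.cast_zero, zero_mul, Finset.sum_const_zero] at this
    push_cast at this
    by_contra! hd'
    linarith [this.2 (by linarith), Int.fract_nonneg (a * x)]
  have hd1 : d < 1 := by
    have := h1 (Sum.elim (fun b => cond b 1 0) 0) (-1) (by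
      rintro ((_ | _) | _) <;> simp [hKz]) (by simpa using hKz)
    rw [intForm_fractTuple, intForm_fractTuple] at this
    simp only [intForm, Pi.zero_apply, Int.cast_zero, zero_mul, Finset.sum_const_zero] at this
    push_cast at this
    linarith [this.1 (by linarith [Int.fract_lt_one (a * x)])]
  obtain ⟨m, k, rfl⟩ := mem_closure_one_iff.1 hd
  have hfr : (m : ℝ) + k * a = Int.fract (a * k) := by
    rw [eq_comm, Int.fract_eq_iff]
    exact ⟨hd0, hd1, -m, by push_cast; ring⟩
  rw [hfr] at h1 h2
  refine ⟨k, fun l hl => ?_, ?_⟩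
  · simp only [intForm_fractTuple_snoc]
    exact h1 _ _ (fun i => hl _) (hl _)
  · rintro (b | i | i)
    · exact h.mono (by nlinarith [Nat.le_mul_of_pos_right K K.factorial_pos]) |>.2 (.inl b)
    · exact h.mono (by nlinarith [Nat.le_mul_of_pos_right K K.factorial_pos]) |>.2 (.inr (.inl i))
    · refine Fin.lastCases ?_ (fun j => ?_) i
      · simpa [fractTuple] using h2
      · simpa [fractTuple] using
          (h.mono (by nlinarith [Nat.le_mul_of_pos_right K K.factorial_pos]) |>.2 (.inr (.inr j)))

end fractTuple

/-! ### Invariance of formulas under similarity -/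

theorem exists_affine_of_term (r : ℝ) {ι : Type*} [Fintype ι] (t : beattyLanguage.Term ι) :
    letI := beattyStructure r
    ∃ (l : ι → ℤ) (q : ℤ), ∀ w : ι → ℤ, t.realize w = ∑ i, l i * w i + q := by
  classical
  let := beattyStructure r
  induction t with
  | var i => exact ⟨Pi.single i 1, 0, fun w => by simp [Pi.single_apply]⟩
  | func f ts ih =>
    choose l q h using ih
    change BeattyFunc _ at f
    cases f with
    | add =>
      refine ⟨l 0 + l 1, q 0 + q 1, fun w => ?_⟩
      change (ts 0).realize w + (ts 1).realize w = _
      simp only [h, Pi.add_apply, add_mul, Finset.sum_add_distrib]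
      ring
    | neg =>
      refine ⟨-l 0, -q 0, fun w => ?_⟩
      change -(ts 0).realize w = _
      simp only [h, Pi.neg_apply, neg_mul, Finset.sum_neg_distrib]
      ring
    | zero => exact ⟨0, 0, fun w => by simp; rfl⟩
    | one => exact ⟨0, 1, fun w => by simp; rfl⟩

/-- Truth of a formula is invariant under `K`-similarity for some `K`. -/
theorem exists_sim_realize {r : ℝ} (hr : 1 < r) (hirr : Irrational r) {V : Type*} [Fintype V]
    {n : ℕ} (φ : beattyLanguage.BoundedFormula V n) :
    letI := beattyStructure r
    ∃ K : ℕ, ∀ (v v' : V → ℤ) (xs xs' : Fin n → ℤ),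
      Sim (AddSubgroup.closure {1, r⁻¹}) K (fractTuple r⁻¹ (Sum.elim v xs))
        (fractTuple r⁻¹ (Sum.elim v' xs')) → φ.Realize v xs → φ.Realize v' xs' := by
  let := beattyStructure r
  have ha0 : 0 < r⁻¹ := inv_pos.2 (by linarith)
  have ha1 : r⁻¹ < 1 := inv_lt_one_of_one_lt₀ hr
  induction φ with
  | falsum => exact ⟨0, fun _ _ _ _ _ h => h⟩
  | equal t₁ t₂ =>
    obtain ⟨l₁, q₁, h₁⟩ := exists_affine_of_term r t₁
    obtain ⟨l₂, q₂, h₂⟩ := exists_affine_of_term r t₂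
    obtain ⟨K, hK⟩ := exists_sim_affine ha0 ha1 hirr.inv (AddSubgroup.closure {1, r⁻¹})
      (l₁ - l₂) (q₁ - q₂)
    refine ⟨K, fun v v' xs xs' hs h => ?_⟩
    change t₁.realize _ = t₂.realize _ at h
    change t₁.realize _ = t₂.realize _
    have := (hK _ _ hs).1
    simp only [Pi.sub_apply, sub_mul, Finset.sum_sub_distrib] at this
    rw [h₁, h₂] at h ⊢
    linarith [this (by linarith)]
  | rel R ts =>
    change BeattyRel _ at R
    cases R with
    | P =>
      obtain ⟨l, q, h⟩ := exists_affine_of_term r (ts 0)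
      obtain ⟨K, hK⟩ := exists_sim_affine ha0 ha1 hirr.inv (AddSubgroup.closure {1, r⁻¹}) l q
      refine ⟨K, fun v v' xs xs' hs hP => ?_⟩
      change (ts 0).realize _ ∈ beattySet r at hP
      change (ts 0).realize _ ∈ beattySet r
      rw [h, mem_beattySet_iff hr hirr] at hP ⊢
      exact (hK _ _ hs).2 hP
  | imp φ ψ ih₁ ih₂ =>
    obtain ⟨K₁, h₁⟩ := ih₁
    obtain ⟨K₂, h₂⟩ := ih₂
    exact ⟨max K₁ K₂, fun v v' xs xs' hs h hφ =>
      h₂ _ _ _ _ (hs.mono (le_max_right _ _))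
        (h (h₁ _ _ _ _ (hs.symm.mono (le_max_left _ _)) hφ))⟩
  | all φ ih =>
    obtain ⟨K, hK⟩ := ih
    -- `Sim.exists_snoc` needs a positive bound, hence K + 1. It is applied in reverse: the
    -- challenge x extends the second tuple and is answered in the first.
    refine ⟨2 * (K + 1) ^ 2 + (K + 1) * (K + 1).factorial, fun v v' xs xs' hs h x => ?_⟩
    obtain ⟨x', hx'⟩ := hs.symm.exists_snoc hirr.inv (Nat.le_add_left 1 K) x
    exact hK _ _ _ _ (hx'.symm.mono (Nat.le_succ K)) (h x')


/-! ### Bounded gaps of infinite definable sets -/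

theorem exists_syndetic {a : ℝ} (hirr : Irrational a) {δ : ℝ} (hδ : 0 < δ) :
    ∃ M : ℕ, ∀ u : ℝ, ∃ e q : ℤ, |e| ≤ M ∧ |a * e - q - u| < δ := by
  let U : ℕ → Set ℝ := fun M => {u | ∃ e q : ℤ, |e| ≤ M ∧ |a * e - q - u| < δ}
  have hU : ∀ M, IsOpen (U M) := fun M => by
    have : U M = ⋃ e : ℤ, ⋃ q : ℤ, ⋃ _ : |e| ≤ M, {u | |a * e - q - u| < δ} := by
      ext u; simp [U]
    rw [this]
    exact isOpen_iUnion fun e => isOpen_iUnion fun q => isOpen_iUnion fun _ =>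
      isOpen_lt (by fun_prop) continuous_const
  -- Density gives each u some e; compactness of [0,1] makes the bound on e uniform, and integer
  -- shifts extend it to ℝ.
  have hcov : Set.Icc (0 : ℝ) 1 ⊆ ⋃ M, U M := fun u _ => by
    obtain ⟨y, hy1, hy2⟩ := (dense_closure_one hirr).exists_dist_lt u hδ
    obtain ⟨m, n, rfl⟩ := mem_closure_one_iff.1 hy1
    refine Set.mem_iUnion.2 ⟨n.natAbs, n, -m, by simp, ?_⟩
    rw [dist_comm, Real.dist_eq] at hy2
    convert hy2 using 2
    push_cast; ring
  have hmono : Monotone U := fun M M' hM u ⟨e, q, he, h⟩ =>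
    ⟨e, q, he.trans (by exact_mod_cast hM), h⟩
  obtain ⟨M, hM⟩ := isCompact_Icc.elim_directed_cover U hU hcov hmono.directed_le
  refine ⟨M, fun u => ?_⟩
  obtain ⟨e, q, he, h⟩ := hM ⟨Int.fract_nonneg u, (Int.fract_lt_one u).le⟩
  refine ⟨e, q - ⌊u⌋, he, ?_⟩
  rw [Int.fract] at h
  convert h using 2
  push_cast; ring

theorem fract_mul_injective {a : ℝ} (hirr : Irrational a) :
    Function.Injective fun x : ℤ => Int.fract (a * x) := by
  intro x y h
  obtain ⟨z, hz⟩ := Int.fract_eq_fract.1 h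
  by_contra hne
  refine (hirr.mul_intCast (sub_ne_zero.2 hne)).ne_int z ?_
  rw [← hz]; push_cast; ring

/-- Finitely many affine functions, each constant or nonzero at `h`, keep their signs near `h`. -/
theorem exists_forall_affine_pos_iff {κ : Type*} {S : Set κ} (hS : S.Finite) (k c : κ → ℝ) {h : ℝ}
    (hne : ∀ l ∈ S, k l ≠ 0 → k l * h + c l ≠ 0) :
    ∃ ε > 0, ∀ h', |h' - h| < ε → ∀ l ∈ S, (0 < k l * h + c l ↔ 0 < k l * h' + c l) := by
  have : ∀ᶠ h' in nhds h, ∀ l ∈ S, (0 < k l * h + c l ↔ 0 < k l * h' + c l) := by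
    rw [Filter.eventually_all_finite hS]
    intro l hl
    by_cases hk : k l = 0
    · simp [hk]
    have hc : Continuous fun h' => k l * h' + c l := by fun_prop
    rcases lt_or_gt_of_ne (hne l hl hk) with h0 | h0
    · filter_upwards [(isOpen_lt hc continuous_const).mem_nhds h0] with h' hh
      exact ⟨fun h1 => absurd h1 h0.le.not_gt, fun h1 => absurd h1 (le_of_lt hh).not_gt⟩
    · filter_upwards [(isOpen_lt continuous_const hc).mem_nhds h0] with h' hh
      exact ⟨fun _ => hh, fun _ => h0⟩
  simpa only [Metric.eventually_nhds_iff, Real.dist_eq] using this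

/-- If `X` contains with some `x` every `x' ≡ x` modulo `N` such that `a x'` is close to `a x`
modulo `N`, then `X` meets every sufficiently long interval. -/
theorem backwardUniformGaps_of_nearby {a : ℝ} (hirr : Irrational a) {X : Set ℤ} {N : ℕ}
    (hN : 0 < N) (x : ℤ) {ε : ℝ} (hε : 0 < ε)
    (hX : ∀ z q : ℤ, |N * (a * z - q)| < ε → x + N * z ∈ X) : BackwardUniformGaps X := by
  have hNR : (0 : ℝ) < N := by exact_mod_cast hN
  obtain ⟨M, hM⟩ := exists_syndetic hirr (div_pos hε hNR)
  refine ⟨N * (2 * M + 2), by positivity, fun y _ => ?_⟩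
  -- Centred so that for every |e| ≤ M the point x + N(e₀ + e) lies between N and N(2M + 2) below y.
  set e₀ := (y - x) / N - M - 1 with he₀
  obtain ⟨e, q, he, h⟩ := hM (-(a * e₀))
  have hNz : (0 : ℤ) < N := by exact_mod_cast hN
  have h1 := Int.mul_ediv_add_emod (y - x) N
  have h2 := Int.emod_nonneg (y - x) hNz.ne'
  have h3 := Int.emod_lt_of_pos (y - x) hNz
  have he' := abs_le.1 he
  have h4 : y - (x + N * (e₀ + e)) = (y - x) % N + N * (M + 1 - e) := by
    rw [he₀]; linear_combination -h1
  refine ⟨x + N * (e₀ + e), hX _ q ?_, ?_, ?_⟩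
  · rw [abs_mul, abs_of_pos hNR, ← lt_div_iff₀' hNR]
    rwa [show a * ((e₀ + e : ℤ) : ℝ) - q = a * e - q - -(a * e₀) by push_cast; ring]
  · push_cast
    nlinarith
  · nlinarith

theorem backwardUniformGaps_of_definable {r : ℝ} (hr : 1 < r) (hirr : Irrational r) {X : Set ℤ}
    (hinf : X.Infinite) (hdef : BeattyDefinable₁ r X) : BackwardUniformGaps X := by
  let := beattyStructure r
  obtain ⟨A, -, hA⟩ := Set.definable_iff_finitely_definable.1 hdef
  obtain ⟨φ, hφ⟩ := Set.definable_iff_exists_formula_sum.1 hA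
  set v : ℤ → (A : Set ℤ) ⊕ Fin 1 → ℤ := fun x => Sum.elim (↑) fun _ => x with hv
  have hXφ : ∀ x, x ∈ X ↔ BoundedFormula.Realize φ (v x) default := fun x => by
    have := Set.ext_iff.1 hφ fun _ => x
    simp only [Set.mem_ofPred_eq] at this
    exact this.trans (iff_of_eq (congrArg (BoundedFormula.Realize φ _) (Subsingleton.elim _ _)))
  obtain ⟨K, hK⟩ := exists_sim_realize hr hirr φ
  set a := r⁻¹ with ha
  let T : ℤ → Bool ⊕ (((A : Set ℤ) ⊕ Fin 1) ⊕ Fin 0) → ℝ := fun x =>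
    fractTuple a (Sum.elim (v x) default)
  let S := {l : Bool ⊕ (((A : Set ℤ) ⊕ Fin 1) ⊕ Fin 0) → ℤ | ∀ i, |l i| ≤ K}
  have hS : S.Finite := finite_setOf_abs_le K
  let k : (Bool ⊕ (((A : Set ℤ) ⊕ Fin 1) ⊕ Fin 0) → ℤ) → ℝ := fun l => l (.inr (.inl (.inr 0)))
  let c : (Bool ⊕ (((A : Set ℤ) ⊕ Fin 1) ⊕ Fin 0) → ℤ) → ℝ := fun l => intForm l (T 0)
  have hT : ∀ l x, intForm l (T x) = k l * Int.fract (a * x) + c l := fun l x => by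
    simp only [intForm, T, k, c, hv, fractTuple, Fintype.sum_sum_type, Sum.elim_inl, Sum.elim_inr,
      Fin.sum_univ_one, Int.cast_zero, mul_zero, Int.fract_zero]
    ring
  -- Avoid the zeros of the nonconstant forms, and also 0, so that small shifts of fract(ax) do not
  -- wrap around.
  obtain ⟨_, ⟨x, hx, rfl⟩, hxB⟩ :=
    (hinf.image (fract_mul_injective hirr.inv).injOn).exists_notMem_finite
      ((hS.image fun l => -c l / k l).insert 0)
  simp only [Set.mem_insert_iff, not_or] at hxB
  obtain ⟨hx0, hxB⟩ := hxB
  obtain ⟨ε, hε, hεS⟩ := exists_forall_affine_pos_iff hS k c (h := Int.fract (a * x))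
    fun l hl hk h0 => hxB ⟨l, hl, by
      change -c l / k l = Int.fract (a * x)
      rw [div_eq_iff hk]; linarith⟩
  have hpos : 0 < Int.fract (a * x) := lt_of_le_of_ne (Int.fract_nonneg _) (Ne.symm hx0)
  have hlt := Int.fract_lt_one (a * x)
  refine backwardUniformGaps_of_nearby hirr.inv K.factorial_pos x
    (ε := min ε (min (Int.fract (a * x)) (1 - Int.fract (a * x))))
    (lt_min hε (lt_min hpos (by linarith))) fun z q hzq => ?_
  obtain ⟨h1, h2⟩ := lt_min_iff.1 hzq
  obtain ⟨h2, h3⟩ := lt_min_iff.1 h2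
  have hfr : Int.fract (a * (x + K.factorial * z : ℤ)) =
      Int.fract (a * x) + K.factorial * (a * z - q) := by
    rw [Int.fract_eq_iff]
    refine ⟨by linarith [(abs_lt.1 h2).1], by linarith [(abs_lt.1 h3).2],
      ⌊a * x⌋ + K.factorial * q, ?_⟩
    rw [Int.fract]; push_cast; ring
  rw [hXφ] at hx ⊢
  refine hK _ _ default default ⟨fun l hl => ?_, ?_⟩ hx
  · change 0 < intForm l (T _) ↔ 0 < intForm l (T _)
    rw [hT, hT, hfr]
    exact hεS _ (by simpa using h1) l hl
  · rintro (b | (p | i) | i)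
    · exact ⟨0, zero_mem _, by simp [fractTuple]⟩
    · exact ⟨0, zero_mem _, by simp [fractTuple, hv]⟩
    · refine ⟨q - a * z, mem_closure_one_iff.2 ⟨q, -z, by push_cast; ring⟩, ?_⟩
      change Int.fract (a * x) - Int.fract (a * (x + K.factorial * z : ℤ)) = _
      rw [hfr]; ring
    · exact i.elim0

/-! ### Undefinability of the order -/

theorem not_backwardUniformGaps_pos : ¬ BackwardUniformGaps {x : ℤ | 0 < x} := by
  rintro ⟨M, -, hM⟩
  obtain ⟨x, hx, -, hx1⟩ := hM 1 (show (0 : ℤ) < 1 from one_pos)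
  exact absurd hx1 (by have : 0 < x := hx; omega)

/-- Cut the order by fixing the first coordinate at the parameter 0, then project to the second. -/
theorem BeattyDefinable₂.definable_pos {r : ℝ} (h : BeattyDefinable₂ r {p : ℤ × ℤ | p.1 < p.2}) :
    BeattyDefinable₁ r {x : ℤ | 0 < x} := by
  let := beattyStructure r
  have h0 : (Set.univ : Set ℤ).Definable beattyLanguage {x : Fin 2 → ℤ | x 0 = 0} := by
    refine Set.definable_iff_exists_formula_sum.2
      ⟨Term.equal (.var (.inr 0)) (.var (.inl ⟨0, trivial⟩)), ?_⟩
    ext x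
    simp
  refine (congrArg (Set.Definable Set.univ beattyLanguage) ?_).mpr
    ((h.inter h0).image_comp fun _ : Fin 1 => (1 : Fin 2))
  ext x
  constructor
  · intro hx
    exact ⟨![0, x 0], ⟨hx, rfl⟩, by ext i; fin_cases i; rfl⟩
  · rintro ⟨y, ⟨h1, h2⟩, rfl⟩
    have h1 : y 0 < y 1 := h1
    have h2 : y 0 = 0 := h2
    change 0 < y 1
    omega

theorem mainTheorem6 (r : ℝ) (hr : 1 < r) (hirr : Irrational r) :
    ¬ BeattyDefinable₂ r {p : ℤ × ℤ | p.1 < p.2} ∧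
    (∀ X : Set ℤ, X.Infinite → BeattyDefinable₁ r X → BackwardUniformGaps X) ∧
    ¬ BackwardUniformGaps {x : ℤ | 0 < x} := by
  refine ⟨fun h => not_backwardUniformGaps_pos ?_,
    fun X => backwardUniformGaps_of_definable hr hirr, not_backwardUniformGaps_pos⟩
  exact backwardUniformGaps_of_definable hr hirr (Set.Ioi_infinite 0) h.definable_pos
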